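/- For a finite simple graph $G$, let $\alpha(G)$ be its stability number (the maximum size of a stable set, i.e. a set of pairwise non-adjacent vertices) and let $F(G)$ be its Fibonacci index (the number of stable sets of $G$, including the empty set). For an integer $n \ge 5$ let $$\mathcal P_G(n) = \operatorname{conv}\{(\alpha(G), F(G)) : G \text{ a graph of order } n\} \subset \mathbb R^2 .$$ Consider the $n$ linear inequalities $$y \ge (2^k-1)x + 2^k(1-k) + n \quad (k = 1, 2, \dots, n-1), \qquad y \le \frac{2^n-n-1}{n-1}(x-1) + n+1 .$$ Then these inequalities form a complete and minimal description of $\mathcal P_G(n)$: a point $(x,y) \in \mathbb R^2$ belongs to $\mathcal P_G(n)$ if and only if it satisfies all of them, and this fails if any one of them is dropped. Moreover, $\mathcal P_G(n)$ has exactly $n$ facets, and they are precisely the sets of points of $\mathcal P_G(n)$ at which one of these $n$ inequalities holds with equality. (A facet of a polytope $P$ is a nonempty set of the form $\{p \in P : \ell(p) = c\}$, where $\ell$ is linear and $\ell \le c$ on $P$, whose dimension is $\dim P - 1$.) -/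

import Mathlib

/-- The Fibonacci index `F(G)`: the number of stable (independent) sets of `G`,
the empty set included. -/
noncomputable def fibonacciIndex {V : Type*} (G : SimpleGraph V) : ℕ :=
  {s : Finset V | G.IsIndepSet (s : Set V)}.ncard

/-- The convex hull in the plane of the points `(α(G), F(G))`, for `G` a graph of order `n`
(every such graph is isomorphic to a graph on `Fin n`, and both invariants are invariant under
isomorphism). -/
noncomputable def polyG (n : ℕ) : Set (ℝ × ℝ) :=
  convexHull ℝ {p : ℝ × ℝ | ∃ G : SimpleGraph (Fin n),
    (G.indepNum : ℝ) = p.1 ∧ (fibonacciIndex G : ℝ) = p.2}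

/-- `F` is a facet of `P`: it is cut out of `P` by equality in a linear inequality `l x ≤ c` that is
valid on `P`, it is nonempty, and its affine dimension is one less than that of `P`. -/
def IsFacet {E : Type*} [AddCommGroup E] [Module ℝ E] (P F : Set E) : Prop :=
  (∃ (l : E →ₗ[ℝ] ℝ) (c : ℝ), (∀ x ∈ P, l x ≤ c) ∧ F = {x ∈ P | l x = c}) ∧
  F.Nonempty ∧
  Module.finrank ℝ (vectorSpan ℝ F) + 1 = Module.finrank ℝ (vectorSpan ℝ P)

/-- The right-hand side `(2 ^ k - 1) x + 2 ^ k (1 - k) + n` of the `k`-th lower inequality. -/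
def lowerLine (n k : ℕ) (x : ℝ) : ℝ :=
  ((2 : ℝ) ^ k - 1) * x + (2 : ℝ) ^ k * (1 - (k : ℝ)) + (n : ℝ)

/-- The right-hand side `(2 ^ n - n - 1) / (n - 1) * (x - 1) + n + 1` of the upper inequality. -/
noncomputable def upperLine (n : ℕ) (x : ℝ) : ℝ :=
  ((2 : ℝ) ^ n - (n : ℝ) - 1) / ((n : ℝ) - 1) * (x - 1) + (n : ℝ) + 1

/-! Write `n` for the order and `a` for the stability number. A maximum stable set contributes its
`2 ^ a` subsets and the other vertices contribute `n - a` singletons, so `F ≥ 2 ^ a - a + n`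
(`le_fibonacciIndex`). Equality holds for `cliqueJoinIndep`. This bound is a convex sequence in `a`,
and the lower inequalities are the lines through its consecutive points.

The upper line is the chord joining the points for `a = 1` and `a = n`. No graph lies above it: `a =
1` forces a complete graph; for `a = 2` Turán's theorem bounds the edges of the complement; for `a ≥
3` a deletion recursion gives `F ≤ (4/3) ^ a * (3/2) ^ n` (`fibonacciIndex_le_pow`), which is convex
in `a`, hence below the chord once it is so at `a = 3` and `a = n`.

Conversely, the first and last lower lines meet the upper line at `x = 1` and `x = n`, and comparing
slopes confines `x` to `[1, n]`. A point of the region then lies on a vertical segment between two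
chords of the hull (`polyG_eq`). Facets are handled by a general statement on plane regions,
`isFacet_iff_of_finrank_eq_two`. -/

namespace SimpleGraph

open Finset

/-! ### Bounds on the number of stable sets -/

/-- The independent sets of `G` contained in `S`. -/
noncomputable def indepSubsets {V : Type*} (G : SimpleGraph V) (S : Finset V) :
    Finset (Finset V) :=
  @Finset.filter _ (fun t : Finset V => G.IsIndepSet (t : Set V)) (Classical.decPred _) S.powerset

theorem mem_indepSubsets {V : Type*} {G : SimpleGraph V} {S t : Finset V} :
    t ∈ G.indepSubsets S ↔ t ⊆ S ∧ G.IsIndepSet (t : Set V) := by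
  simp only [indepSubsets, mem_filter, mem_powerset]

theorem fibonacciIndex_eq_card_indepSubsets {V : Type*} [Fintype V] (G : SimpleGraph V) :
    fibonacciIndex G = #(G.indepSubsets univ) := by
  rw [fibonacciIndex, ← Set.ncard_coe_finset]
  congr 1
  ext s
  simp [mem_indepSubsets]

/-- Deleting a vertex `v` of `S`: the independent sets avoiding `v` are those of `S \ {v}`, and the
others correspond to independent sets avoiding the closed neighborhood of `v`. -/
theorem card_indepSubsets_le_add {V : Type*} [DecidableEq V] (G : SimpleGraph V)
    [DecidableRel G.Adj] (S : Finset V) (v : V) :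
    #(G.indepSubsets S) ≤
      #(G.indepSubsets (S.erase v)) + #(G.indepSubsets {w ∈ S.erase v | ¬ G.Adj v w}) := by
  refine (card_le_card (t := G.indepSubsets (S.erase v) ∪
    (G.indepSubsets {w ∈ S.erase v | ¬ G.Adj v w}).image (insert v)) ?_).trans
    ((card_union_le _ _).trans (Nat.add_le_add_left card_image_le _))
  intro t ht
  rw [mem_indepSubsets] at ht
  obtain ⟨hS, hI⟩ := ht
  rw [mem_union, mem_image]
  by_cases hv : v ∈ t
  · refine Or.inr ⟨t.erase v, mem_indepSubsets.2 ⟨fun w hw => ?_, hI.mono (by simp)⟩,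
      insert_erase hv⟩
    have hw' := mem_erase.1 hw
    simp only [mem_filter, mem_erase]
    exact ⟨⟨hw'.1, hS hw'.2⟩, hI hv hw'.2 hw'.1.symm⟩
  · exact Or.inl (mem_indepSubsets.2 ⟨subset_erase.2 ⟨hS, hv⟩, hI⟩)

/-- A bound `A ^ a * B ^ #S` survives the induction when `A * B = 2` (stable `S`) and `A * B + 1 = A
* B ^ 2` (deletion of a non-isolated vertex). These two equations give `A = 4/3` and `B = 3/2`. -/
theorem card_indepSubsets_le_of_forall_card_le {V : Type*} (G : SimpleGraph V) (S : Finset V) (a : ℕ)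
    (h : ∀ t ⊆ S, G.IsIndepSet (t : Set V) → #t ≤ a) :
    (#(G.indepSubsets S) : ℝ) ≤ (4 / 3) ^ a * (3 / 2) ^ #S := by
  classical
  induction S using Finset.strongInduction generalizing a with
  | H S ih =>
  by_cases hI : G.IsIndepSet (S : Set V)
  · have hle := h S subset_rfl hI
    calc (#(G.indepSubsets S) : ℝ) ≤ 2 ^ #S := by
          have : #(G.indepSubsets S) ≤ 2 ^ #S :=
            (card_le_card fun t ht => mem_powerset.2 (mem_indepSubsets.1 ht).1).trans
              (card_powerset S).le
          exact_mod_cast this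
      _ = (4 / 3) ^ #S * (3 / 2) ^ #S := by rw [← mul_pow]; norm_num
      _ ≤ (4 / 3) ^ a * (3 / 2) ^ #S := by
          gcongr
          norm_num
  · simp only [SimpleGraph.isIndepSet_iff, Set.Pairwise] at hI
    push Not at hI
    obtain ⟨v, hv, w, hw, hne, hadj⟩ := hI
    rw [mem_coe] at hv hw
    obtain ⟨b, rfl⟩ : ∃ b, a = b + 1 := by
      have := h {v} (by simpa using hv) (by simp)
      exact ⟨a - 1, by simp at this; omega⟩
    -- `T` misses both `v` and its neighbor `w`, and `v` can be added to any stable subset of `T`: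
    -- the size drops by at least two, the stability bound by one.
    set T : Finset V := {w ∈ S.erase v | ¬ G.Adj v w} with hT
    have hTS : T ⊆ (S.erase v).erase w := fun x hx => by
      simp only [hT, mem_filter, mem_erase] at hx ⊢
      exact ⟨fun e => hx.2 (e ▸ hadj), hx.1⟩
    have hc1 : #(S.erase v) + 1 = #S := card_erase_add_one hv
    have hc2 : #((S.erase v).erase w) + 1 = #(S.erase v) :=
      card_erase_add_one (mem_erase.2 ⟨hne.symm, hw⟩)
    obtain ⟨m, hm⟩ : ∃ m, #S = m + 2 := ⟨#((S.erase v).erase w), by omega⟩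
    have hcT : #T ≤ m := (card_le_card hTS).trans (by omega)
    have h1 := ih (S.erase v) (erase_ssubset hv) (b + 1)
      fun t ht => h t (ht.trans (erase_subset _ _))
    have h2 := ih T (((filter_subset _ _).trans_ssubset (erase_ssubset hv))) b fun t ht hti => by
      have hvt : v ∉ t := fun hvt => by simpa [hT] using ht hvt
      have := h (insert v t) (insert_subset hv fun x hx => by
        have := ht hx
        simp only [hT, mem_filter, mem_erase] at this
        exact this.1.2) (by
          rw [coe_insert]
          refine Set.Pairwise.insert hti fun x hx _ => ?_
          have := ht hx
          simp only [hT, mem_filter, mem_erase] at this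
          exact ⟨this.2, fun e => this.2 e.symm⟩)
      rw [card_insert_of_notMem hvt] at this
      omega
    have h3 : (#(G.indepSubsets S) : ℝ) ≤ #(G.indepSubsets (S.erase v)) + #(G.indepSubsets T) := by
      exact_mod_cast G.card_indepSubsets_le_add S v
    have h4 : (4 / 3 : ℝ) ^ b * (3 / 2) ^ #T ≤ (4 / 3) ^ b * (3 / 2) ^ m := by
      gcongr
      norm_num
    rw [show #(S.erase v) = m + 1 by omega] at h1
    rw [hm]
    calc (#(G.indepSubsets S) : ℝ) ≤ (4 / 3) ^ (b + 1) * (3 / 2) ^ (m + 1) + (4 / 3) ^ b * (3 / 2) ^ m := by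
          linarith
      _ = (4 / 3) ^ (b + 1) * (3 / 2) ^ (m + 2) := by ring

theorem fibonacciIndex_le_pow {V : Type*} [Fintype V] (G : SimpleGraph V) :
    (fibonacciIndex G : ℝ) ≤ (4 / 3) ^ G.indepNum * (3 / 2) ^ Fintype.card V := by
  rw [fibonacciIndex_eq_card_indepSubsets]
  exact G.card_indepSubsets_le_of_forall_card_le univ _ fun t _ ht => ht.card_le_indepNum

/-- The only possible stable sets are the empty set, singletons and edges of the complement. -/
theorem fibonacciIndex_le_card_edgeFinset_compl {V : Type*} [Fintype V] [DecidableEq V]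
    (G : SimpleGraph V) [DecidableRel G.Adj] (h : G.indepNum ≤ 2) :
    fibonacciIndex G ≤ Fintype.card V + 1 + #Gᶜ.edgeFinset := by
  classical
  rw [fibonacciIndex_eq_card_indepSubsets]
  refine (card_le_card (t := insert ∅ (univ.image fun v : V => {v}) ∪
    Gᶜ.edgeFinset.image Sym2.toFinset) ?_).trans ((card_union_le _ _).trans
      (add_le_add ((card_insert_le _ _).trans (Nat.add_le_add_right card_image_le _))
        card_image_le))
  intro t ht
  have hI := (mem_indepSubsets.1 ht).2
  have hc := hI.card_le_indepNum.trans h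
  simp only [mem_union, mem_insert, mem_image, mem_univ, true_and]
  interval_cases hn : #t
  · exact Or.inl (Or.inl (card_eq_zero.1 hn))
  · obtain ⟨v, rfl⟩ := card_eq_one.1 hn
    exact Or.inl (Or.inr ⟨v, rfl⟩)
  · obtain ⟨v, w, hvw, rfl⟩ := card_eq_two.1 hn
    refine Or.inr ⟨s(v, w), ?_, Sym2.toFinset_mk_eq⟩
    simp only [mem_edgeFinset, mem_edgeSet, compl_adj]
    exact ⟨hvw, hI (by simp) (by simp) hvw⟩

theorem fibonacciIndex_le_of_indepNum_le_one {V : Type*} [Fintype V]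
    (G : SimpleGraph V) (h : G.indepNum ≤ 1) : fibonacciIndex G ≤ Fintype.card V + 1 := by
  classical
  have h1 := G.fibonacciIndex_le_card_edgeFinset_compl (h.trans one_le_two)
  suffices Gᶜ.edgeFinset = ∅ by simpa [this] using h1
  refine eq_empty_of_forall_notMem fun e he => ?_
  induction e with
  | h v w =>
  rw [mem_edgeFinset, mem_edgeSet, compl_adj] at he
  have : #({v, w} : Finset V) ≤ G.indepNum := IsIndepSet.card_le_indepNum (by
    simpa [Set.pairwise_pair, G.adj_comm w v] using fun _ => he.2)
  rw [card_pair he.1] at this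
  omega

theorem four_mul_fibonacciIndex_le_of_indepNum_le_two {V : Type*} [Fintype V]
    (G : SimpleGraph V) (h : G.indepNum ≤ 2) :
    4 * fibonacciIndex G ≤ 4 * (Fintype.card V + 1) + Fintype.card V ^ 2 := by
  classical
  have h1 := G.fibonacciIndex_le_card_edgeFinset_compl h
  -- A triangle of the complement would be a stable set of size three, so Turán's bound applies.
  have h2 : Gᶜ.CliqueFree (2 + 1) := fun t ht => by
    have := ((isClique_compl G).1 ht.isClique).card_le_indepNum
    rw [ht.card_eq] at this
    omega
  have h3 := h2.card_edgeFinset_le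
  dsimp only at h3
  rw [← card_edgeFinset_turanGraph] at h3
  have h4 := mul_card_edgeFinset_turanGraph_le (n := Fintype.card V) (r := 2)
  omega

theorem le_fibonacciIndex {V : Type*} [Fintype V] (G : SimpleGraph V) :
    2 ^ G.indepNum + Fintype.card V ≤ fibonacciIndex G + G.indepNum := by
  classical
  obtain ⟨s, hs⟩ := G.exists_isNIndepSet_indepNum
  have hdis : Disjoint s.powerset (sᶜ.image fun v : V => {v}) := by
    rw [Finset.disjoint_left]
    rintro t ht ht'
    obtain ⟨v, hv, rfl⟩ := mem_image.1 ht'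
    exact mem_compl.1 hv (singleton_subset_iff.1 (mem_powerset.1 ht))
  have h1 : #(s.powerset ∪ sᶜ.image fun v : V => {v}) ≤ fibonacciIndex G := by
    rw [fibonacciIndex_eq_card_indepSubsets]
    refine card_le_card fun t ht => ?_
    rw [mem_indepSubsets]
    refine ⟨subset_univ t, ?_⟩
    rcases mem_union.1 ht with ht | ht
    · exact hs.isIndepSet.mono (by simpa using ht)
    · obtain ⟨v, hv, rfl⟩ := mem_image.1 ht
      simp
  rw [card_union_of_disjoint hdis, card_powerset, hs.card_eq,
    card_image_of_injective _ singleton_injective] at h1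
  have := card_compl_add_card s
  rw [hs.card_eq] at this
  omega

/-! ### Graphs attaining the lower bound -/

/-- The graph in which the vertices of `s` are pairwise non-adjacent and any other pair of
distinct vertices is adjacent. -/
def cliqueJoinIndep {V : Type*} (s : Set V) : SimpleGraph V where
  Adj v w := v ≠ w ∧ ¬ (v ∈ s ∧ w ∈ s)
  symm := ⟨fun _ _ h => ⟨h.1.symm, fun h' => h.2 h'.symm⟩⟩
  loopless := ⟨fun _ h => h.1 rfl⟩

theorem isIndepSet_cliqueJoinIndep_iff {V : Type*} {s t : Set V} :
    (cliqueJoinIndep s).IsIndepSet t ↔ t ⊆ s ∨ t.Subsingleton := by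
  constructor
  · intro h
    refine or_iff_not_imp_left.2 fun hts => ?_
    obtain ⟨v, hv, hvs⟩ := Set.not_subset.1 hts
    have key : ∀ w ∈ t, w = v := fun w hw => by
      by_contra hne
      exact h hw hv hne ⟨hne, fun h' => hvs h'.2⟩
    exact fun x hx y hy => (key x hx).trans (key y hy).symm
  · rintro (h | h) v hv w hw hne hadj
    · exact hadj.2 ⟨h hv, h hw⟩
    · exact hne (h hv hw)

theorem indepNum_cliqueJoinIndep {V : Type*} [Fintype V] {s : Finset V} (hs : s.Nonempty) :
    (cliqueJoinIndep (s : Set V)).indepNum = #s := by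
  refine le_antisymm ?_
    (IsIndepSet.card_le_indepNum (isIndepSet_cliqueJoinIndep_iff.2 (Or.inl subset_rfl)))
  obtain ⟨t, ht⟩ := (cliqueJoinIndep (s : Set V)).exists_isNIndepSet_indepNum
  rw [← ht.card_eq]
  rcases isIndepSet_cliqueJoinIndep_iff.1 ht.isIndepSet with h | h
  · exact card_le_card (by simpa using h)
  · exact (card_le_one.2 fun a ha b hb => h ha hb).trans hs.card_pos

theorem fibonacciIndex_cliqueJoinIndep {V : Type*} [Fintype V] {s : Finset V} (hs : s.Nonempty) :
    fibonacciIndex (cliqueJoinIndep (s : Set V)) + #s = 2 ^ #s + Fintype.card V := by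
  classical
  refine le_antisymm ?_ ?_
  · have h1 : fibonacciIndex (cliqueJoinIndep (s : Set V)) ≤
        #(s.powerset ∪ sᶜ.image fun v : V => {v}) := by
      rw [fibonacciIndex_eq_card_indepSubsets]
      refine card_le_card fun t ht => ?_
      rcases isIndepSet_cliqueJoinIndep_iff.1 (mem_indepSubsets.1 ht).2 with h | h
      · exact mem_union_left _ (by simpa using h)
      · by_cases hts : t ⊆ s
        · exact mem_union_left _ (mem_powerset.2 hts)
        · obtain ⟨v, hv, hvs⟩ := not_subset.1 hts
          refine mem_union_right _ (mem_image.2 ⟨v, mem_compl.2 hvs, ?_⟩)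
          ext w
          rw [mem_singleton]
          exact ⟨fun e => e ▸ hv, fun hw => h hw hv⟩
    have h2 := h1.trans (card_union_le _ _)
    rw [card_powerset, card_image_of_injective _ singleton_injective] at h2
    have := card_compl_add_card s
    omega
  · have := (cliqueJoinIndep (s : Set V)).le_fibonacciIndex
    rwa [indepNum_cliqueJoinIndep hs] at this

end SimpleGraph

/-! ### Facets of a plane region -/

/-- If a plane region is cut out by finitely many linear inequalities, each of which is an equality
at two distinct points of the region and strict at some point of it, then the facets of the region
are exactly the sets of equality in one of the inequalities. -/
theorem isFacet_iff_of_finrank_eq_two {E ι : Type*} [AddCommGroup E] [Module ℝ E] [Finite ι]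
    [Nonempty ι] (hE : Module.finrank ℝ E = 2) (f : ι → E →ₗ[ℝ] ℝ) (b : ι → ℝ)
    (hne : ∀ i, ∃ p q : E, p ≠ q ∧ (∀ j, f j p ≤ b j) ∧ (∀ j, f j q ≤ b j) ∧
      f i p = b i ∧ f i q = b i)
    (hlt : ∀ i, ∃ p : E, (∀ j, f j p ≤ b j) ∧ f i p < b i) (F : Set E) :
    IsFacet {p | ∀ j, f j p ≤ b j} F ↔ ∃ i, F = {p ∈ {p | ∀ j, f j p ≤ b j} | f i p = b i} := by
  have : FiniteDimensional ℝ E := Module.finite_of_finrank_eq_succ hE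
  set P : Set E := {p | ∀ j, f j p ≤ b j} with hP
  have ker_one : ∀ l : E →ₗ[ℝ] ℝ, l ≠ 0 → Module.finrank ℝ (LinearMap.ker l) = 1 := by
    intro l hl
    have h1 := l.finrank_range_add_finrank_ker
    rw [LinearMap.range_eq_top.2 (LinearMap.surjective hl), finrank_top, Module.finrank_self,
      hE] at h1
    omega
  have ker_eq : ∀ l : E →ₗ[ℝ] ℝ, l ≠ 0 → ∀ u : E, u ≠ 0 → l u = 0 →
      LinearMap.ker l = Submodule.span ℝ {u} := by
    intro l hl u hu hlu
    refine (Submodule.eq_of_le_of_finrank_eq ?_ ?_).symm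
    · rw [Submodule.span_singleton_le_iff_mem]
      exact hlu
    · rw [finrank_span_singleton hu, ker_one l hl]
  have f_ne : ∀ i, f i ≠ 0 := by
    intro i h0
    obtain ⟨p, q, -, -, -, hp, -⟩ := hne i
    obtain ⟨r, -, hr⟩ := hlt i
    simp only [h0, LinearMap.zero_apply] at hp hr
    exact hr.ne hp
  have span_face : ∀ i, Module.finrank ℝ (vectorSpan ℝ {p ∈ P | f i p = b i}) = 1 := by
    intro i
    obtain ⟨p, q, hpq, hp, hq, hip, hiq⟩ := hne i
    refine le_antisymm ?_ ?_
    · rw [← ker_one (f i) (f_ne i)]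
      refine Submodule.finrank_mono (Submodule.span_le.2 ?_)
      rintro _ ⟨x, hx, y, hy, rfl⟩
      simp [hx.2, hy.2]
    · rw [← finrank_span_singleton (K := ℝ) (sub_ne_zero.2 hpq)]
      refine Submodule.finrank_mono ?_
      rw [Submodule.span_singleton_le_iff_mem]
      exact vsub_mem_vectorSpan ℝ ⟨hp, hip⟩ ⟨hq, hiq⟩
  have span_P : Module.finrank ℝ (vectorSpan ℝ P) = 2 := by
    obtain ⟨i⟩ := ‹Nonempty ι›
    refine le_antisymm (hE ▸ Submodule.finrank_le _) ?_
    rw [Nat.succ_le_iff, ← span_face i]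
    refine Submodule.finrank_lt_finrank_of_lt
      (lt_of_le_of_ne (vectorSpan_mono ℝ fun x hx => hx.1) fun heq => ?_)
    obtain ⟨p, q, -, hp, -, hip, -⟩ := hne i
    obtain ⟨r, hr, hir⟩ := hlt i
    have hmem : r - p ∈ vectorSpan ℝ {p ∈ P | f i p = b i} :=
      heq ▸ vsub_mem_vectorSpan ℝ hr hp
    have hle : vectorSpan ℝ {p ∈ P | f i p = b i} ≤ LinearMap.ker (f i) := by
      refine Submodule.span_le.2 ?_
      rintro _ ⟨x, hx, y, hy, rfl⟩
      simp [hx.2, hy.2]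
    have := LinearMap.mem_ker.1 (hle hmem)
    rw [map_sub, sub_eq_zero] at this
    linarith
  constructor
  · rintro ⟨⟨l, c, hl, rfl⟩, hF, hdim⟩
    rw [span_P] at hdim
    have hl0 : l ≠ 0 := by
      rintro rfl
      obtain ⟨p, -, hp⟩ := hF
      rw [LinearMap.zero_apply] at hp
      have : {x ∈ P | (0 : E →ₗ[ℝ] ℝ) x = c} = P := by
        ext x
        simp [← hp]
      rw [this, span_P] at hdim
      omega
    obtain ⟨p, hp, q, hq, hpq⟩ : {x ∈ P | l x = c}.Nontrivial := by
      rw [← Set.not_subsingleton_iff]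
      intro hs
      rw [vectorSpan_of_subsingleton ℝ hs, finrank_bot] at hdim
      omega
    obtain ⟨w, hw⟩ : ∃ w, 0 < l w := by
      obtain ⟨w, hw⟩ := LinearMap.surjective hl0 1
      exact ⟨w, by rw [hw]; exact one_pos⟩
    -- Otherwise every inequality is strict at the midpoint of `p` and `q`, and a small move along
    -- `w` stays in `P` while `l` exceeds `c`.
    obtain ⟨i, hi⟩ : ∃ i, f i p = b i ∧ f i q = b i := by
      by_contra! hcon
      have hev : ∀ j, ∀ᶠ ε : ℝ in nhdsWithin 0 (Set.Ioi 0),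
          f j ((2⁻¹ : ℝ) • (p + q) + ε • w) ≤ b j := by
        intro j
        have hlt : 2⁻¹ * (f j p + f j q) + 0 * f j w < b j := by
          have h1 := hp.1 j
          have h2 := hq.1 j
          rcases h1.lt_or_eq with h | h
          · linarith
          · have := lt_of_le_of_ne h2 (hcon j h)
            linarith
        have hcont : Continuous fun ε : ℝ => 2⁻¹ * (f j p + f j q) + ε * f j w := by fun_prop
        filter_upwards [mem_nhdsWithin_of_mem_nhds
          ((hcont.tendsto 0).eventually (gt_mem_nhds hlt))] with ε hε
        simpa [mul_add] using le_of_lt hε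
      obtain ⟨ε, hε, hpos⟩ := ((Filter.eventually_all.2 hev).and self_mem_nhdsWithin).exists
      have h1 := hl _ hε
      have h2 : 0 < ε * l w := mul_pos hpos hw
      simp only [map_add, map_smul, smul_eq_mul, hp.2, hq.2] at h1
      linarith
    refine ⟨i, ?_⟩
    -- In dimension two, both kernels are the line spanned by `p - q`.
    have hker : LinearMap.ker l = LinearMap.ker (f i) := by
      rw [ker_eq l hl0 (p - q) (sub_ne_zero.2 hpq) (by rw [map_sub, hp.2, hq.2, sub_self]),
        ker_eq (f i) (f_ne i) (p - q) (sub_ne_zero.2 hpq) (by rw [map_sub, hi.1, hi.2, sub_self])]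
    ext x
    refine and_congr_right fun _ => ?_
    rw [← hp.2, ← hi.1, ← sub_eq_zero, ← map_sub, ← sub_eq_zero (b := f i p), ← map_sub,
      ← LinearMap.mem_ker, hker, LinearMap.mem_ker]
  · rintro ⟨i, rfl⟩
    refine ⟨⟨f i, b i, fun x hx => hx i, rfl⟩, ?_, by rw [span_face, span_P]⟩
    obtain ⟨p, q, -, hp, -, hip, -⟩ := hne i
    exact ⟨p, hp, hip⟩

/-! ### Position of the lower and upper lines -/

/-- The second coordinate of the lower vertex of `polyG n` with abscissa `a`. -/
noncomputable def vertexHeight (n a : ℕ) : ℝ := 2 ^ a - a + n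

theorem lowerLine_left (n k : ℕ) : lowerLine n k k = vertexHeight n k := by
  unfold lowerLine vertexHeight
  ring

theorem lowerLine_right (n k : ℕ) : lowerLine n k (k + 1) = vertexHeight n (k + 1) := by
  unfold lowerLine vertexHeight
  push_cast
  ring

/-- The gap is `2 ^ a + 2 ^ k * (k - a - 1)`, a positive integer away from the two endpoints. The
full unit of slack is what the minimality argument uses. -/
theorem lowerLine_add_one_le (n : ℕ) {k a : ℕ} (h : a ≠ k) (h' : a ≠ k + 1) :
    lowerLine n k a + 1 ≤ vertexHeight n a := by
  unfold lowerLine vertexHeight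
  have h1 : (1 : ℝ) ≤ 2 ^ k := one_le_pow₀ one_le_two
  have h2 : (1 : ℝ) ≤ 2 ^ a := one_le_pow₀ one_le_two
  rcases lt_or_ge a k with hak | hak
  · have : (a : ℝ) + 1 ≤ k := by exact_mod_cast hak
    nlinarith [mul_nonneg (zero_le_one.trans h1) (sub_nonneg.2 this)]
  · obtain ⟨m, rfl⟩ := Nat.exists_eq_add_of_le hak
    have hm : (m : ℝ) + 2 ≤ 2 ^ m := by
      have : 2 ≤ m := by omega
      clear * - this
      induction m, this using Nat.le_induction with
      | base => norm_num
      | succ m _ ih =>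
        push_cast
        rw [pow_succ]
        have : (0 : ℝ) ≤ m := m.cast_nonneg
        linarith
    rw [pow_add]
    push_cast
    nlinarith [mul_le_mul_of_nonneg_left hm (zero_le_one.trans h1)]

theorem lowerLine_le_vertexHeight (n k a : ℕ) : lowerLine n k a ≤ vertexHeight n a := by
  by_cases h : a = k
  · rw [h, lowerLine_left]
  by_cases h' : a = k + 1
  · subst h'
    rw [← lowerLine_right]
    push_cast
    exact le_rfl
  · linarith [lowerLine_add_one_le n h h']

theorem upperLine_one (n : ℕ) : upperLine n 1 = vertexHeight n 1 := by
  unfold upperLine vertexHeight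
  push_cast
  ring

theorem slope_mul {n : ℕ} (hn : 2 ≤ n) :
    ((2 : ℝ) ^ n - n - 1) / (n - 1) * (n - 1) = 2 ^ n - n - 1 := by
  have : (2 : ℝ) ≤ n := by exact_mod_cast hn
  exact div_mul_cancel₀ _ (by linarith)

theorem upperLine_self {n : ℕ} (hn : 2 ≤ n) : upperLine n n = vertexHeight n n := by
  unfold upperLine vertexHeight
  rw [slope_mul hn]
  ring

/-- This is `n ^ 2 / 4 ≤ (2 ^ n - n - 1) / (n - 1)` with denominators cleared, as needed for
stability number two. -/
theorem sq_bound_nat {n : ℕ} (hn : 5 ≤ n) : n ^ 3 + 4 * n + 4 ≤ 4 * 2 ^ n + n ^ 2 := by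
  induction n, hn using Nat.le_induction with
  | base => norm_num
  | succ n hn ih =>
    rw [pow_succ 2]
    obtain ⟨m, rfl⟩ := Nat.exists_eq_add_of_le hn
    nlinarith [Nat.zero_le (m ^ 3), Nat.zero_le (m ^ 2)]

theorem four_add_sq_le_upperLine {n : ℕ} (hn : 5 ≤ n) :
    4 * ((n : ℝ) + 1) + n ^ 2 ≤ 4 * upperLine n 2 := by
  have h1 : (n : ℝ) ^ 3 + 4 * n + 4 ≤ 4 * 2 ^ n + n ^ 2 := by exact_mod_cast sq_bound_nat hn
  have h2 : (5 : ℝ) ≤ n := by exact_mod_cast hn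
  have h3 : (n : ℝ) ^ 2 / 4 ≤ (2 ^ n - n - 1) / (n - 1) := by
    rw [le_div_iff₀ (by linarith)]
    nlinarith
  unfold upperLine
  linarith

theorem pow_three_halves_bound {n : ℕ} (hn : 5 ≤ n) :
    (64 / 27 : ℝ) * (3 / 2) ^ n * (n - 1) ≤ 2 * (2 ^ n - n - 1) + (n + 1) * (n - 1) := by
  rcases lt_or_ge n 7 with h | h
  · interval_cases n <;> norm_num
  -- This suffices because `(n + 1) * (n - 1) ≥ 2 * (n + 1)`; it fails at `n = 6`, hence the
  -- separate small cases.
  · have key : (32 / 27 : ℝ) * (3 / 2) ^ n * (n - 1) ≤ 2 ^ n := by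
      clear hn
      induction n, h using Nat.le_induction with
      | base => norm_num
      | succ n hn ih =>
        have h2 : (7 : ℝ) ≤ n := by exact_mod_cast hn
        have h3 : (0 : ℝ) ≤ (3 / 2) ^ n := by positivity
        rw [pow_succ, pow_succ]
        push_cast
        nlinarith [mul_nonneg h3 (sub_nonneg.2 h2)]
    have h2 : (7 : ℝ) ≤ n := by exact_mod_cast h
    nlinarith

theorem pow_le_upperLine {n a : ℕ} (hn : 5 ≤ n) (ha : 3 ≤ a) (han : a ≤ n) :
    (4 / 3 : ℝ) ^ a * (3 / 2) ^ n ≤ upperLine n a := by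
  have hn' : (5 : ℝ) ≤ n := by exact_mod_cast hn
  set D : ℝ := ((2 : ℝ) ^ n - n - 1) / (n - 1) with hD
  -- An exponential minus an affine function is convex, so only the endpoints `3` and `n` need
  -- checking.
  have hconv : ConvexOn ℝ Set.univ
      fun x : ℝ => (3 / 2 : ℝ) ^ n * (4 / 3 : ℝ) ^ x - upperLine n x := by
    have h1 : ConvexOn ℝ Set.univ fun x : ℝ => (3 / 2 : ℝ) ^ n * (4 / 3 : ℝ) ^ x :=
      (convexOn_rpow_left (by norm_num)).smul (by positivity)
    refine h1.sub ⟨convex_univ, fun x _ y _ u v _ _ huv => le_of_eq ?_⟩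
    simp only [upperLine, smul_eq_mul]
    rw [← hD]
    linear_combination (n + 1 - D) * huv
  have hle := hconv.le_max_of_mem_Icc (x := 3) (y := (n : ℝ)) (z := (a : ℝ)) trivial trivial
    ⟨by exact_mod_cast ha, by exact_mod_cast han⟩
  have h3 : (3 / 2 : ℝ) ^ n * (4 / 3 : ℝ) ^ (3 : ℝ) - upperLine n 3 ≤ 0 := by
    have h4 : (4 / 3 : ℝ) ^ (3 : ℝ) = 64 / 27 := by
      rw [show (3 : ℝ) = (3 : ℕ) by norm_num, Real.rpow_natCast]
      norm_num
    have h5 : (64 / 27 : ℝ) * (3 / 2) ^ n ≤ 2 * D + (n + 1) := by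
      have h6 : D * (n - 1) = 2 ^ n - n - 1 := slope_mul (by omega)
      refine le_of_mul_le_mul_right (a := (n : ℝ) - 1) ?_ (by linarith)
      linarith [pow_three_halves_bound hn]
    rw [h4]
    unfold upperLine
    rw [← hD]
    linarith
  have hnn : (3 / 2 : ℝ) ^ n * (4 / 3 : ℝ) ^ (n : ℝ) - upperLine n n ≤ 0 := by
    rw [upperLine_self (by omega), Real.rpow_natCast, ← mul_pow, vertexHeight]
    norm_num
  have := hle.trans (max_le h3 hnn)
  rw [Real.rpow_natCast] at this
  linarith

/-! ### Every graph satisfies the inequalities -/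

namespace SimpleGraph

theorem one_le_indepNum {V : Type*} [Finite V] [Nonempty V] (G : SimpleGraph V) :
    1 ≤ G.indepNum := by
  obtain ⟨v⟩ := ‹Nonempty V›
  have : ({v} : Finset V).card ≤ G.indepNum := IsIndepSet.card_le_indepNum (by simp)
  simpa using this

theorem indepNum_le_card {V : Type*} [Fintype V] (G : SimpleGraph V) :
    G.indepNum ≤ Fintype.card V := by
  obtain ⟨s, hs⟩ := G.exists_isNIndepSet_indepNum
  rw [← hs.card_eq]
  exact s.card_le_univ

theorem lowerLine_le_fibonacciIndex {V : Type*} [Fintype V] (G : SimpleGraph V) (k : ℕ) :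
    lowerLine (Fintype.card V) k G.indepNum ≤ fibonacciIndex G := by
  refine (lowerLine_le_vertexHeight _ _ _).trans ?_
  have : (2 : ℝ) ^ G.indepNum + Fintype.card V ≤ fibonacciIndex G + G.indepNum := by
    exact_mod_cast G.le_fibonacciIndex
  unfold vertexHeight
  linarith

theorem fibonacciIndex_le_upperLine {V : Type*} [Fintype V] (G : SimpleGraph V)
    (hV : 5 ≤ Fintype.card V) :
    (fibonacciIndex G : ℝ) ≤ upperLine (Fintype.card V) G.indepNum := by
  have : Nonempty V := Fintype.card_pos_iff.1 (by omega)
  have h1 := G.one_le_indepNum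
  rcases lt_or_ge G.indepNum 3 with h3 | h3
  · rcases lt_or_ge G.indepNum 2 with h2 | h2
    · have ha : G.indepNum = 1 := by omega
      have : (fibonacciIndex G : ℝ) ≤ Fintype.card V + 1 := by
        exact_mod_cast G.fibonacciIndex_le_of_indepNum_le_one ha.le
      rw [ha, Nat.cast_one, upperLine_one, vertexHeight]
      norm_num
      linarith
    · have ha : G.indepNum = 2 := by omega
      have : (4 : ℝ) * fibonacciIndex G ≤ 4 * (Fintype.card V + 1) + (Fintype.card V : ℝ) ^ 2 := by
        exact_mod_cast G.four_mul_fibonacciIndex_le_of_indepNum_le_two ha.le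
      rw [ha, Nat.cast_ofNat]
      linarith [four_add_sq_le_upperLine hV]
  · exact G.fibonacciIndex_le_pow.trans (pow_le_upperLine hV h3 G.indepNum_le_card)

end SimpleGraph

/-! ### The polytope as an intersection of half-planes -/

theorem vertex_mem_polyG {n a : ℕ} (ha : 1 ≤ a) (han : a ≤ n) :
    ((a : ℝ), vertexHeight n a) ∈ polyG n := by
  obtain ⟨s, -, hs⟩ := Finset.exists_subset_card_eq
    (s := (Finset.univ : Finset (Fin n))) (n := a) (by simpa using han)
  have hne : s.Nonempty := Finset.card_pos.1 (by omega)
  refine subset_convexHull ℝ _ ⟨SimpleGraph.cliqueJoinIndep (s : Set (Fin n)), ?_, ?_⟩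
  · rw [SimpleGraph.indepNum_cliqueJoinIndep hne, hs]
  · have h := SimpleGraph.fibonacciIndex_cliqueJoinIndep hne
    rw [hs, Fintype.card_fin] at h
    have h' : (fibonacciIndex (SimpleGraph.cliqueJoinIndep (s : Set (Fin n))) : ℝ) + a =
        2 ^ a + n := by exact_mod_cast h
    rw [vertexHeight]
    linarith

/-- The linear forms of the inequalities `f p ≤ c` describing `polyG n`: the `k`-th lower
inequality for `some k`, the upper inequality for `none`. -/
noncomputable def inequalityForm (n : ℕ) : Option (Set.Icc 1 (n - 1)) → (ℝ × ℝ →ₗ[ℝ] ℝ)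
  | some k => ((2 : ℝ) ^ (k : ℕ) - 1) • LinearMap.fst ℝ ℝ ℝ - LinearMap.snd ℝ ℝ ℝ
  | none => LinearMap.snd ℝ ℝ ℝ - (((2 : ℝ) ^ n - n - 1) / (n - 1)) • LinearMap.fst ℝ ℝ ℝ

/-- The constants of the inequalities describing `polyG n`. -/
noncomputable def inequalityBound (n : ℕ) : Option (Set.Icc 1 (n - 1)) → ℝ
  | some k => -((2 : ℝ) ^ (k : ℕ) * (1 - (k : ℕ)) + n)
  | none => n + 1 - ((2 : ℝ) ^ n - n - 1) / (n - 1)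

section Inequalities

variable {n : ℕ} {p : ℝ × ℝ}

theorem inequalityForm_some_sub (k : Set.Icc 1 (n - 1)) :
    inequalityForm n (some k) p - inequalityBound n (some k) = lowerLine n k p.1 - p.2 := by
  simp only [inequalityForm, inequalityBound, lowerLine, LinearMap.sub_apply, LinearMap.smul_apply,
    LinearMap.fst_apply, LinearMap.snd_apply, smul_eq_mul]
  ring

theorem inequalityForm_none_sub :
    inequalityForm n none p - inequalityBound n none = p.2 - upperLine n p.1 := by
  simp only [inequalityForm, inequalityBound, upperLine, LinearMap.sub_apply, LinearMap.smul_apply,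
    LinearMap.fst_apply, LinearMap.snd_apply, smul_eq_mul]
  ring

theorem inequalityForm_some_le_iff (k : Set.Icc 1 (n - 1)) :
    inequalityForm n (some k) p ≤ inequalityBound n (some k) ↔ lowerLine n k p.1 ≤ p.2 := by
  rw [← sub_nonpos, inequalityForm_some_sub, sub_nonpos]

theorem inequalityForm_some_lt_iff (k : Set.Icc 1 (n - 1)) :
    inequalityForm n (some k) p < inequalityBound n (some k) ↔ lowerLine n k p.1 < p.2 := by
  rw [← sub_neg, inequalityForm_some_sub, sub_neg]

theorem inequalityForm_some_eq_iff (k : Set.Icc 1 (n - 1)) :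
    inequalityForm n (some k) p = inequalityBound n (some k) ↔ p.2 = lowerLine n k p.1 := by
  rw [← sub_eq_zero, inequalityForm_some_sub, sub_eq_zero, eq_comm]

theorem inequalityForm_none_le_iff :
    inequalityForm n none p ≤ inequalityBound n none ↔ p.2 ≤ upperLine n p.1 := by
  rw [← sub_nonpos, inequalityForm_none_sub, sub_nonpos]

theorem inequalityForm_none_lt_iff :
    inequalityForm n none p < inequalityBound n none ↔ p.2 < upperLine n p.1 := by
  rw [← sub_neg, inequalityForm_none_sub, sub_neg]

theorem inequalityForm_none_eq_iff :
    inequalityForm n none p = inequalityBound n none ↔ p.2 = upperLine n p.1 := by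
  rw [← sub_eq_zero, inequalityForm_none_sub, sub_eq_zero]

end Inequalities

theorem setOf_inequalities_eq (n : ℕ) :
    {p | ∀ i, inequalityForm n i p ≤ inequalityBound n i} = {p : ℝ × ℝ |
      (∀ k ∈ Set.Icc 1 (n - 1), p.2 ≥ lowerLine n k p.1) ∧ p.2 ≤ upperLine n p.1} := by
  ext p
  simp only [Set.mem_ofPred_eq, Option.forall, inequalityForm_none_le_iff,
    inequalityForm_some_le_iff, Subtype.forall]
  exact and_comm

theorem Convex.mk_affine_mem {s : Set (ℝ × ℝ)} (hs : Convex ℝ s) {c d a b x : ℝ}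
    (ha : (a, c * a + d) ∈ s) (hb : (b, c * b + d) ∈ s) (hax : a ≤ x) (hxb : x ≤ b) :
    (x, c * x + d) ∈ s := by
  have hconv : Convex ℝ {t : ℝ | (t, c * t + d) ∈ s} := by
    intro t ht u hu v w hv hw hvw
    have := hs ht hu hv hw hvw
    rw [Set.mem_ofPred_eq]
    convert this using 1
    ext
    · simp
    · simp only [Prod.snd_add, Prod.smul_snd, smul_eq_mul]
      linear_combination -d * hvw
  exact hconv.ordConnected.out ha hb ⟨hax, hxb⟩

theorem Convex.mk_mem_of_le_of_le {s : Set (ℝ × ℝ)} (hs : Convex ℝ s) {x y₁ y₂ y : ℝ}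
    (h₁ : (x, y₁) ∈ s) (h₂ : (x, y₂) ∈ s) (h₁y : y₁ ≤ y) (hy₂ : y ≤ y₂) : (x, y) ∈ s := by
  have hconv : Convex ℝ {t : ℝ | (x, t) ∈ s} := by
    intro t ht u hu v w hv hw hvw
    have := hs ht hu hv hw hvw
    rw [Set.mem_ofPred_eq]
    convert this using 1
    ext
    · simp only [Prod.fst_add, Prod.smul_fst, smul_eq_mul]
      linear_combination -x * hvw
    · simp
  exact hconv.ordConnected.out h₁ h₂ ⟨h₁y, hy₂⟩

theorem upperLine_mem_polyG {n : ℕ} (hn : 2 ≤ n) {x : ℝ} (h1 : 1 ≤ x) (hxn : x ≤ n) :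
    (x, upperLine n x) ∈ polyG n := by
  have hl := vertex_mem_polyG (n := n) le_rfl (by omega)
  have hr := vertex_mem_polyG (n := n) (a := n) (by omega) le_rfl
  rw [← upperLine_one, Nat.cast_one] at hl
  rw [← upperLine_self hn] at hr
  have key : ∀ x, upperLine n x = ((2 : ℝ) ^ n - n - 1) / (n - 1) * x +
      (n + 1 - ((2 : ℝ) ^ n - n - 1) / (n - 1)) := fun x => by
    unfold upperLine
    ring
  rw [key] at hl hr ⊢
  exact (convex_convexHull ℝ _).mk_affine_mem hl hr h1 hxn

theorem lowerLine_mem_polyG {n k : ℕ} (hk : 1 ≤ k) (hkn : k + 1 ≤ n) {x : ℝ} (h1 : k ≤ x)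
    (hxk : x ≤ k + 1) : (x, lowerLine n k x) ∈ polyG n := by
  have hl := vertex_mem_polyG (n := n) hk (by omega)
  have hr := vertex_mem_polyG (n := n) (a := k + 1) (by omega) hkn
  rw [← lowerLine_left] at hl
  rw [← lowerLine_right, Nat.cast_succ] at hr
  unfold lowerLine at hl hr ⊢
  rw [add_assoc] at hl hr ⊢
  exact (convex_convexHull ℝ _).mk_affine_mem hl hr h1 hxk

theorem one_lt_slope {n : ℕ} (hn : 5 ≤ n) : (1 : ℝ) < (2 ^ n - n - 1) / (n - 1) := by
  have hn' : (5 : ℝ) ≤ n := by exact_mod_cast hn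
  have h : (2 : ℝ) * n < 2 ^ n := by
    have : 2 * n < 2 ^ n := by
      induction n, hn using Nat.le_induction with
      | base => norm_num
      | succ m hm ih =>
        have := ih (by exact_mod_cast hm)
        rw [pow_succ]
        omega
    exact_mod_cast this
  rw [one_lt_div (by linarith)]
  linarith

theorem slope_lt {n : ℕ} (hn : 5 ≤ n) :
    ((2 : ℝ) ^ n - n - 1) / (n - 1) < 2 ^ (n - 1) - 1 := by
  have hn' : (5 : ℝ) ≤ n := by exact_mod_cast hn
  obtain ⟨m, rfl⟩ : ∃ m, n = m + 1 := ⟨n - 1, by omega⟩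
  have h : (1 : ℝ) ≤ 2 ^ m := one_le_pow₀ one_le_two
  rw [div_lt_iff₀ (by linarith), Nat.add_sub_cancel, pow_succ]
  nlinarith [mul_nonneg (sub_nonneg.2 h) (sub_nonneg.2 hn')]

theorem polyG_eq {n : ℕ} (hn : 5 ≤ n) : polyG n = {p : ℝ × ℝ |
    (∀ k ∈ Set.Icc 1 (n - 1), p.2 ≥ lowerLine n k p.1) ∧ p.2 ≤ upperLine n p.1} := by
  refine Set.Subset.antisymm ?_ ?_
  · refine convexHull_min ?_ ?_
    · rintro ⟨x, y⟩ ⟨G, hx, hy⟩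
      dsimp only at hx hy
      subst hx hy
      have h1 := G.lowerLine_le_fibonacciIndex
      have h2 := G.fibonacciIndex_le_upperLine (by simpa using hn)
      rw [Fintype.card_fin] at h2
      exact ⟨fun k _ => by simpa using h1 k, h2⟩
    · rw [← setOf_inequalities_eq]
      intro p hp q hq u v hu hv huv i
      rw [map_add, map_smul, map_smul, smul_eq_mul, smul_eq_mul]
      calc _ ≤ u * inequalityBound n i + v * inequalityBound n i :=
            add_le_add (mul_le_mul_of_nonneg_left (hp i) hu) (mul_le_mul_of_nonneg_left (hq i) hv)
        _ = inequalityBound n i := by rw [← add_mul, huv, one_mul]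
  · rintro ⟨x, y⟩ ⟨hlow, hup⟩
    dsimp only at hlow hup
    have h1 : 1 ≤ x := by
      have h := (hlow 1 ⟨le_rfl, by omega⟩).le.trans hup
      unfold lowerLine upperLine at h
      have := one_lt_slope hn
      by_contra! hx
      norm_num at h
      nlinarith
    have hxn : x ≤ n := by
      have h := (hlow (n - 1) ⟨by omega, le_rfl⟩).le.trans hup
      have e1 := lowerLine_right n (n - 1)
      have e2 := upperLine_self (n := n) (by omega)
      have hc : ((n - 1 : ℕ) : ℝ) + 1 = n := by
        rw [← Nat.cast_succ, Nat.succ_eq_add_one, Nat.sub_add_cancel (by omega)]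
      rw [Nat.sub_add_cancel (by omega), hc, ← e2] at e1
      unfold lowerLine upperLine at h e1
      have := slope_lt hn
      by_contra! hx
      nlinarith
    obtain ⟨k, hk, hkn, hkx, hxk⟩ : ∃ k : ℕ, 1 ≤ k ∧ k + 1 ≤ n ∧ (k : ℝ) ≤ x ∧ x ≤ k + 1 := by
      -- At `x = n` the floor would overshoot the last edge, so `k = n - 1` is taken instead.
      rcases hxn.lt_or_eq with h | rfl
      · refine ⟨⌊x⌋₊, (Nat.one_le_floor_iff x).2 h1, ?_, Nat.floor_le (by linarith),
          (Nat.lt_floor_add_one x).le⟩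
        exact (Nat.floor_lt (by linarith)).2 h
      · refine ⟨n - 1, by omega, by omega, ?_, ?_⟩
        · exact_mod_cast Nat.sub_le n 1
        · exact_mod_cast (by omega : n ≤ n - 1 + 1)
    exact (convex_convexHull ℝ _).mk_mem_of_le_of_le (lowerLine_mem_polyG hk hkn hkx hxk)
      (upperLine_mem_polyG (by omega) h1 hxn) (hlow k ⟨hk, by omega⟩) hup

/-! ### Minimality and the facets -/

theorem lowerLine_mem_of_vertex_mem {n k a : ℕ} (h : vertexHeight n a = lowerLine n k a) :
    a = k ∨ a = k + 1 := by
  by_contra! hcon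
  linarith [lowerLine_add_one_le n hcon.1 hcon.2]

/-- The midpoint value averages the values at `j` and `j + 1`; at least one of these vertices is off
line `k`, hence a unit above it. -/
theorem lowerLine_half_le {n k j : ℕ} (hkj : k ≠ j) :
    lowerLine n k (j + 1 / 2) ≤ lowerLine n j (j + 1 / 2) - 1 / 2 := by
  have e1 : ∀ i : ℕ, lowerLine n i (j + 1 / 2) =
      (lowerLine n i j + lowerLine n i ((j + 1 : ℕ) : ℝ)) / 2 := fun i => by
    unfold lowerLine
    push_cast
    ring
  rw [e1, e1, lowerLine_left, Nat.cast_succ j, lowerLine_right, ← Nat.cast_succ]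
  have h1 := lowerLine_le_vertexHeight n k j
  have h2 := lowerLine_le_vertexHeight n k (j + 1)
  by_cases h : j = k + 1
  · have := lowerLine_add_one_le n (k := k) (a := j + 1) (by omega) (by omega)
    linarith
  · have := lowerLine_add_one_le n (k := k) (a := j) hkj.symm h
    linarith

/-- The subset of `polyG n` where the inequality with index `i` is an equality. -/
def inequalityFace (n : ℕ) (i : Option (Set.Icc 1 (n - 1))) : Set (ℝ × ℝ) :=
  {p ∈ polyG n | inequalityForm n i p = inequalityBound n i}

theorem inequalityFace_some (n : ℕ) (k : Set.Icc 1 (n - 1)) :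
    inequalityFace n (some k) = {p ∈ polyG n | p.2 = lowerLine n k p.1} := by
  simp only [inequalityFace, inequalityForm_some_eq_iff]

theorem inequalityFace_none (n : ℕ) :
    inequalityFace n none = {p ∈ polyG n | p.2 = upperLine n p.1} := by
  simp only [inequalityFace, inequalityForm_none_eq_iff]

theorem isFacet_polyG_iff {n : ℕ} (hn : 5 ≤ n) (F : Set (ℝ × ℝ)) :
    IsFacet (polyG n) F ↔ ∃ i, F = inequalityFace n i := by
  have hP : polyG n = {p | ∀ i, inequalityForm n i p ≤ inequalityBound n i} := by
    rw [setOf_inequalities_eq, polyG_eq hn]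
  have hv : ∀ a : ℕ, 1 ≤ a → a ≤ n →
      ∀ i, inequalityForm n i ((a : ℝ), vertexHeight n a) ≤ inequalityBound n i := by
    intro a ha han
    have := vertex_mem_polyG ha han
    rwa [hP] at this
  have vertex_ne : ∀ {a b : ℕ}, a ≠ b →
      ((a : ℝ), vertexHeight n a) ≠ ((b : ℝ), vertexHeight n b) := fun h h' =>
    h (Nat.cast_injective (congrArg Prod.fst h'))
  unfold inequalityFace
  rw [hP]
  refine isFacet_iff_of_finrank_eq_two (by simp) (inequalityForm n) (inequalityBound n) ?_ ?_ F
  · rintro (_ | k)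
    · refine ⟨_, _, vertex_ne (a := 1) (b := n) (by omega), hv 1 le_rfl (by omega),
        hv n (by omega) le_rfl, ?_, ?_⟩
      · rw [inequalityForm_none_eq_iff, Nat.cast_one, upperLine_one]
      · rw [inequalityForm_none_eq_iff, upperLine_self (by omega)]
    · have h1 := k.2.1
      have h2 := k.2.2
      refine ⟨_, _, vertex_ne (a := k) (b := k + 1) (by omega), hv k h1 (by omega),
        hv (k + 1) (by omega) (by omega), ?_, ?_⟩
      · rw [inequalityForm_some_eq_iff, lowerLine_left]
      · rw [inequalityForm_some_eq_iff, Nat.cast_succ, lowerLine_right]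
  · rintro (_ | k)
    · refine ⟨_, hv 2 (by omega) (by omega), ?_⟩
      rw [inequalityForm_none_lt_iff]
      have h5 : (5 : ℝ) ≤ n := by exact_mod_cast hn
      have h4 := four_add_sq_le_upperLine hn
      rw [vertexHeight]
      norm_num
      nlinarith
    · have h2 := k.2.2
      -- Any vertex off the `k`-th edge makes its inequality strict.
      obtain ⟨a, ha, han, hak, hak'⟩ : ∃ a : ℕ, 1 ≤ a ∧ a ≤ n ∧ a ≠ k ∧ a ≠ k + 1 := by
        by_cases h : (k : ℕ) ≤ 2
        · exact ⟨4, by omega, by omega, by omega, by omega⟩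
        · exact ⟨1, by omega, by omega, by omega, by omega⟩
      refine ⟨_, hv a ha han, ?_⟩
      rw [inequalityForm_some_lt_iff]
      linarith [lowerLine_add_one_le n hak hak']

/-- Faces are told apart by their vertices: lower face `k` contains exactly those at `k` and `k +
1`, whereas the upper face contains those at `1` and `n`. -/
theorem inequalityFace_injective {n : ℕ} (hn : 5 ≤ n) : Function.Injective (inequalityFace n) := by
  have key : ∀ (k : Set.Icc 1 (n - 1)) (a : ℕ),
      ((a : ℝ), vertexHeight n a) ∈ inequalityFace n (some k) → a = k ∨ a = k + 1 := by
    intro k a h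
    rw [inequalityFace_some] at h
    exact lowerLine_mem_of_vertex_mem h.2
  have hl : ∀ k : Set.Icc 1 (n - 1),
      (((k : ℕ) : ℝ), vertexHeight n k) ∈ inequalityFace n (some k) := by
    intro k
    have h1 := k.2.1
    have h2 := k.2.2
    rw [inequalityFace_some]
    exact ⟨vertex_mem_polyG h1 (by omega), (lowerLine_left n k).symm⟩
  have hr : ∀ k : Set.Icc 1 (n - 1),
      (((k + 1 : ℕ) : ℝ), vertexHeight n (k + 1)) ∈ inequalityFace n (some k) := by
    intro k
    have h2 := k.2.2
    rw [inequalityFace_some]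
    refine ⟨vertex_mem_polyG (by omega) (by omega), ?_⟩
    rw [Nat.cast_succ, lowerLine_right]
  have hne : ∀ k, inequalityFace n (some k) ≠ inequalityFace n none := by
    intro k h
    have h1 : (((1 : ℕ) : ℝ), vertexHeight n 1) ∈ inequalityFace n (some k) := by
      rw [h, inequalityFace_none]
      refine ⟨vertex_mem_polyG le_rfl (by omega), ?_⟩
      rw [Nat.cast_one, upperLine_one]
    have h2 : ((n : ℝ), vertexHeight n n) ∈ inequalityFace n (some k) := by
      rw [h, inequalityFace_none]
      exact ⟨vertex_mem_polyG (by omega) le_rfl, (upperLine_self (by omega)).symm⟩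
    have := key k 1 h1
    have := key k n h2
    omega
  rintro (_ | k) (_ | j) h
  · rfl
  · exact absurd h.symm (hne j)
  · exact absurd h (hne k)
  · have h1 := key j k (h ▸ hl k)
    have h2 := key j (k + 1) (h ▸ hr k)
    exact congrArg some (Subtype.ext (by omega))

theorem theorem5p1 (n : ℕ) (hn : 5 ≤ n) :
    -- the inequalities describe the polytope
    polyG n = {p : ℝ × ℝ |
      (∀ k ∈ Set.Icc 1 (n - 1), p.2 ≥ lowerLine n k p.1) ∧ p.2 ≤ upperLine n p.1} ∧
    -- no inequality of the system can be dropped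
    (∀ j ∈ Set.Icc 1 (n - 1), polyG n ≠ {p : ℝ × ℝ |
      (∀ k ∈ Set.Icc 1 (n - 1), k ≠ j → p.2 ≥ lowerLine n k p.1) ∧ p.2 ≤ upperLine n p.1}) ∧
    (polyG n ≠ {p : ℝ × ℝ | ∀ k ∈ Set.Icc 1 (n - 1), p.2 ≥ lowerLine n k p.1}) ∧
    -- the facets are exactly the sets where one of the inequalities is an equality
    (∀ F : Set (ℝ × ℝ), IsFacet (polyG n) F ↔
      (∃ k ∈ Set.Icc 1 (n - 1), F = {p ∈ polyG n | p.2 = lowerLine n k p.1}) ∨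
      F = {p ∈ polyG n | p.2 = upperLine n p.1}) ∧
    -- there are exactly `n` of them
    {F : Set (ℝ × ℝ) | IsFacet (polyG n) F}.ncard = n := by
  refine ⟨polyG_eq hn, ?_, ?_, ?_, ?_⟩
  · intro j hj h
    -- The midpoint of the `j`-th edge, lowered by `1 / 2`, violates inequality `j` alone.
    have hmem : ((j : ℝ) + 1 / 2, lowerLine n j (j + 1 / 2)) ∈ polyG n := by
      have h2 := hj.2
      exact lowerLine_mem_polyG hj.1 (by have := hj.1; omega) (by linarith) (by linarith)
    have hup : lowerLine n j (j + 1 / 2) ≤ upperLine n (j + 1 / 2) := by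
      rw [polyG_eq hn] at hmem
      exact hmem.2
    have hout : ((j : ℝ) + 1 / 2, lowerLine n j (j + 1 / 2) - 1 / 2) ∈ polyG n := by
      rw [h]
      exact ⟨fun k _ hkj => lowerLine_half_le hkj, by dsimp only; linarith⟩
    rw [polyG_eq hn] at hout
    have := hout.1 j hj
    dsimp only at this
    linarith
  · intro h
    have hmem := vertex_mem_polyG (n := n) (a := 1) le_rfl (by omega)
    -- Raising a vertex on the upper line keeps all the lower inequalities.
    have hout : (((1 : ℕ) : ℝ), vertexHeight n 1 + 1) ∈ polyG n := by
      rw [h] at hmem ⊢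
      exact fun k hk => (hmem k hk).trans (by dsimp only; linarith)
    rw [polyG_eq hn] at hout
    have := hout.2
    rw [Nat.cast_one, upperLine_one] at this
    linarith
  · intro F
    rw [isFacet_polyG_iff hn, Option.exists, or_comm]
    simp only [inequalityFace_some, inequalityFace_none, Subtype.exists, exists_prop]
  · have : {F : Set (ℝ × ℝ) | IsFacet (polyG n) F} = Set.range (inequalityFace n) := by
      ext F
      rw [Set.mem_ofPred_eq, isFacet_polyG_iff hn, Set.mem_range]
      simp only [eq_comm]
    rw [this, ← Set.image_univ, Set.ncard_image_of_injective _ (inequalityFace_injective hn),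
      Set.ncard_univ, Finite.card_option, Nat.card_eq_fintype_card]
    simp
    omega
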